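/- **Conventions.** An alphabet is a set $U=U^-\,\dot\cup\,\{0\}\,\dot\cup\,U^+$ of negative labels, zero, and positive labels; $U^{\ge 0}=\{0\}\cup U^+$. Let $T$ be a complete theory without finite models and $p(x)$ a complete $1$-type of $T$ over $\varnothing$; for $T$ one uses alphabets with $|U|\ge|S_n(T)|$ for all $n$. $\mathrm{PF}(p)$ is the set of formulas $\varphi(x,y)$ such that, for $a\models p$, the formula $\varphi(a,y)$ is consistent, isolates a complete type over $a$, and implies $p(y)$. Two such formulas are $\mathrm{PE}(p)$-equivalent if $\varphi(a,y)$ and $\psi(a,y)$ have the same solutions for $a\models p$. A pair $(a,b)$ of realizations of $p$ is a principal arc if $\varphi(a,b)$ holds for some $\varphi\in\mathrm{PF}(p)$; a class in $\mathrm{PF}(p)/\mathrm{PE}(p)$ is reversible (respectively irreversible) if for its arcs $(a,b)$ the pair $(b,a)$ is (respectively is not) a principal arc. A regular labelling function for $p$ is an injective map $\nu(p):\mathrm{PF}(p)/\mathrm{PE}(p)\to U$ sending exactly the irreversible classes to negative labels, exactly the reversible classes to non-negative labels, and the class of $x\approx y$ to $0$; $\theta_u$ denotes a formula whose class has label $u$,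 and $\rho_{\nu(p)}$ the image of $\nu(p)$. For $u,v\in\rho_{\nu(p)}$, $\lfloor u,v\rfloor$ is the set of all labels $w\in\rho_{\nu(p)}$ such that $\theta_w(a,y)\vdash\exists z(\theta_u(a,z)\wedge\theta_v(z,y))$ for $a\models p$. If every $\lfloor u,v\rfloor$ is a singleton, $\mathfrak P'_{\nu(p)}=\langle\rho_{\nu(p)};\odot\rangle$ is defined by $\lfloor u,v\rfloor=\{u\odot v\}$. For monoids $\mathcal S_1,\mathcal S_2$ with unit $0$ on sets $S_1\subseteq U^-\cup\{0\}$ and $S_2\subseteq U^{\ge0}$, the successively-annihilating band $\mathcal S_1[\mathcal S_2]$ is $\langle S_1\cup S_2;\odot\rangle$, where $\odot$ extends both operations and $u\odot v=v\odot u=u$ for $u\in S_1$, $u<0$, and $v\in S_2$, $v>0$. **Theorem 5.2.** Let $U$ be an infinite alphabet, let $\langle G;\ast\rangle$ be a group with $G\subseteq U^{\ge 0}$ and unit $0$, let $-1\in U^-$, and let $\langle\{-1,0\};+\rangle$ be the monoid with unit $0$ and idempotent $-1$. Then there are a complete theory $T$ without finite models, with $|S_n(T)|\le|U|$ for every $n$,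 a type $p\in S_1(T)$, and a regular labelling function $\nu(p)$ into $U$ such that all sets $\lfloor u,v\rfloor$, $u,v\in\rho_{\nu(p)}$, are singletons and $\mathfrak P'_{\nu(p)}$ coincides with $\langle\{-1,0\};+\rangle[\langle G;\ast\rangle]$. Moreover, for any strictly increasing sequence $(c_k)_{k\in\omega}$ of rationals with $c_k\to\infty$, $T$ can be taken to be the theory of the structure on $\mathbb Q\times G$ with the relations $(q,x)<(r,y)\Leftrightarrow q<r$; $\neg(\xi<\eta)\wedge\neg(\eta<\xi)$; the unary predicates $R_k=\{c_k\}\times G$, $k\in\omega$; and $Q_g=\{((q,x),(q,x\ast g))\mid q\in\mathbb Q,\ x\in G\}$, $g\in G$ (Ehrenfeucht's example with each point replaced by a copy of the regular $G$-polygon). -/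

import Mathlib

universe u v

open FirstOrder FirstOrder.Language

namespace IsolatingFormulas

/-! ## Alphabets of labels -/

/-- An alphabet of labels: a set `U` that is the disjoint union of the set `neg` of negative
labels, the singleton of the label `zero`, and the set `pos` of positive labels. -/
structure Alphabet (U : Type u) where
  neg : Set U
  zero : U
  pos : Set U
  zero_notMem_neg : zero ∉ neg
  zero_notMem_pos : zero ∉ pos
  disjoint_neg_pos : Disjoint neg pos
  cover : ∀ w, w ∈ neg ∨ w = zero ∨ w ∈ pos

/-- The non-negative labels. -/
def Alphabet.nonneg {U : Type u} (A : Alphabet U) : Set U := A.pos ∪ {A.zero}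

/-! ## Binary isolating formulas over a realization of a complete 1-type -/

section Types

variable {L : FirstOrder.Language.{u, v}} {T : L.Theory}

/-- The element `a` of a model of `T` realizes the 1-type `p`. -/
def Realizes (p : T.CompleteType (Fin 1)) {M : Theory.ModelType.{u, v, max u v} T} (a : M) :
    Prop :=
  T.typeOf (fun _ : Fin 1 => a) = p

/-- `φ(a, y)` implies `ψ(a, y)` whenever `a` realizes `p`. -/
def Implies (p : T.CompleteType (Fin 1)) (φ ψ : L.Formula (Fin 2)) : Prop :=
  ∀ (M : Theory.ModelType.{u, v, max u v} T) (a b : M),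
    Realizes p a → φ.Realize ![a, b] → ψ.Realize ![a, b]

/-- `φ(a, y)` is a principal (isolating) formula over a realization `a` of `p`:
it is consistent and it decides every formula `ψ(a, y)`. -/
def IsPrincipal (p : T.CompleteType (Fin 1)) (φ : L.Formula (Fin 2)) : Prop :=
  (∃ (M : Theory.ModelType.{u, v, max u v} T) (a b : M), Realizes p a ∧ φ.Realize ![a, b]) ∧
    ∀ ψ : L.Formula (Fin 2), Implies p φ ψ ∨ Implies p φ (∼ψ)

/-- `PF(p)`: the formulas `φ(x, y)` such that, for `a` realizing `p`, the formula `φ(a, y)` is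
principal and implies `p(y)`. -/
def PF (p : T.CompleteType (Fin 1)) : Set (L.Formula (Fin 2)) :=
  {φ | IsPrincipal p φ ∧
    ∀ (M : Theory.ModelType.{u, v, max u v} T) (a b : M),
      Realizes p a → φ.Realize ![a, b] → Realizes p b}

/-- `PE(p)`: equivalence of formulas of `PF(p)` over the realizations of `p`. -/
def PE (p : T.CompleteType (Fin 1)) : Setoid (PF p) where
  r φ ψ := ∀ (M : Theory.ModelType.{u, v, max u v} T) (a b : M),
    Realizes p a → (φ.1.Realize ![a, b] ↔ ψ.1.Realize ![a, b])
  iseqv :=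
    { refl := fun _ _ _ _ _ => Iff.rfl
      symm := fun h M a b ha => (h M a b ha).symm
      trans := fun h₁ h₂ M a b ha => (h₁ M a b ha).trans (h₂ M a b ha) }

/-- The classes of `PF(p)` modulo `PE(p)`. -/
abbrev IsolatingClass (p : T.CompleteType (Fin 1)) := Quotient (PE p)

/-- The class of a formula of `PF(p)`. -/
def classOf {p : T.CompleteType (Fin 1)} (φ : PF p) : IsolatingClass p := Quotient.mk (PE p) φ

/-- `(a, b)` is a principal arc, by some formula, between realizations of `p`. -/
def IsPrincipalArc (p : T.CompleteType (Fin 1)) {M : Theory.ModelType.{u, v, max u v} T}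
    (a b : M) : Prop :=
  Realizes p a ∧ ∃ φ ∈ PF p, φ.Realize ![a, b]

/-- `PFS(p)`: the classes whose arcs `(a, b)` are reversible, that is, correspond to principal
edges. -/
def PFS (p : T.CompleteType (Fin 1)) : Set (IsolatingClass p) :=
  {E | ∃ φ : PF p, classOf φ = E ∧
    ∀ (M : Theory.ModelType.{u, v, max u v} T) (a b : M),
      Realizes p a → φ.1.Realize ![a, b] → IsPrincipalArc p b a}

/-- `PFN(p)`: the classes whose arcs `(a, b)` are irreversible. -/
def PFN (p : T.CompleteType (Fin 1)) : Set (IsolatingClass p) :=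
  {E | ∃ φ : PF p, classOf φ = E ∧
    ∀ (M : Theory.ModelType.{u, v, max u v} T) (a b : M),
      Realizes p a → φ.1.Realize ![a, b] → ¬ IsPrincipalArc p b a}

variable (L) in
/-- The formula `x ≈ y`. -/
def eqFormula : L.Formula (Fin 2) := Term.equal (Term.var 0) (Term.var 1)

/-- `ν` is a regular labelling function for the 1-type `p`: it is injective, negative labels are
those of irreversible arcs, non-negative labels are those of edges, and `0` is the label
of `x ≈ y`. -/
structure IsRegularLabelling {U : Type*} (A : Alphabet U) (p : T.CompleteType (Fin 1))
    (ν : IsolatingClass p → U) : Prop where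
  injective : Function.Injective ν
  mem_neg_iff : ∀ E, ν E ∈ A.neg ↔ E ∈ PFN p
  mem_nonneg_iff : ∀ E, ν E ∈ A.nonneg ↔ E ∈ PFS p
  eq_label : ∃ h : eqFormula L ∈ PF p, ν (classOf ⟨eqFormula L, h⟩) = A.zero

/-- `⌊w₁, w₂⌋`: the labels `w` such that `θ_w(a, y)` implies `∃ z, θ_{w₁}(a, z) ∧ θ_{w₂}(z, y)`
for `a` realizing `p`, where `θ_w` is a formula of `PF(p)` with the label `w`. -/
def labelProd {U : Type*} {p : T.CompleteType (Fin 1)} (ν : IsolatingClass p → U) (w₁ w₂ : U) :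
    Set U :=
  {w | ∃ θ θ₁ θ₂ : PF p, ν (classOf θ) = w ∧ ν (classOf θ₁) = w₁ ∧ ν (classOf θ₂) = w₂ ∧
    ∀ (M : Theory.ModelType.{u, v, max u v} T) (a b : M),
      Realizes p a → θ.1.Realize ![a, b] →
        ∃ z : M, θ₁.1.Realize ![a, z] ∧ θ₂.1.Realize ![z, b]}

/-- The algebra of labels is deterministic, and the algebra `𝔓'` on the set of labels in use,
given by `⌊w₁, w₂⌋ = {w₁ ⊙ w₂}`, coincides with the algebra with universe `S` and
operation `op`. -/
def GeneratingAlgebraIs {U : Type*} {p : T.CompleteType (Fin 1)} (ν : IsolatingClass p → U)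
    (S : Set U) (op : S → S → S) : Prop :=
  Set.range ν = S ∧ ∀ w₁ w₂ : S, labelProd ν w₁ w₂ = {(op w₁ w₂ : U)}

end Types

/-! ## Composition of monoids of labels -/

section Composition

open Classical in
/-- The operation of the composition (successively-annihilating band) `S₁[S₂]` of a monoid
`(S₁, op₁)` of non-positive labels and a monoid `(S₂, op₂)` of non-negative labels with the same
unit `0`: it extends both operations, and a product of a negative and a positive label, in any
order, is the negative one. -/
noncomputable def bandOp {U : Type u} (S₁ S₂ : Set U) (op₁ : S₁ → S₁ → S₁) (op₂ : S₂ → S₂ → S₂)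
    (x y : ↥(S₁ ∪ S₂)) : ↥(S₁ ∪ S₂) :=
  if h₁ : x.1 ∈ S₁ ∧ y.1 ∈ S₁ then
    ⟨op₁ ⟨x, h₁.1⟩ ⟨y, h₁.2⟩, Or.inl (Subtype.property _)⟩
  else if h₂ : x.1 ∈ S₂ ∧ y.1 ∈ S₂ then
    ⟨op₂ ⟨x, h₂.1⟩ ⟨y, h₂.2⟩, Or.inr (Subtype.property _)⟩
  else if x.1 ∈ S₁ then x else y

open Classical in
/-- The operation of the monoid `{m, 0}` with the unit `0` and the idempotent `m`. -/
noncomputable def twoOp {U : Type u} (A : Alphabet U) (m : U) (x y : ({m, A.zero} : Set U)) :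
    ({m, A.zero} : Set U) :=
  if x.1 = A.zero then y else x

end Composition

/-! ## Ehrenfeucht's example with points replaced by copies of a regular polygon -/

/-- The relation symbols `<`, incomparability, `R_k`, and `Q_g`. -/
inductive PolyRel (G : Type u) : ℕ → Type u
  | lt : PolyRel G 2
  | incomp : PolyRel G 2
  | const (k : ℕ) : PolyRel G 1
  | act (g : G) : PolyRel G 2

/-- The relational language with the symbols `PolyRel G`. -/
abbrev polyLang (G : Type u) : FirstOrder.Language.{0, u} := ⟨fun _ => Empty, PolyRel G⟩

/-- The universe `ℚ × G` of the structure: every rational is replaced by a copy of `G`. -/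
def EhrPoly (G : Type u) (_c : ℕ → ℚ) : Type u := ℚ × G

/-- `(q, x) < (r, y)` iff `q < r`; distinct copies of `G` are comparable and each copy is an
antichain; `R_k` is the copy at the rational `c k`; `Q_g` consists of the pairs `(x, x * g)` inside
each copy. -/
instance {G : Type u} [Group G] (c : ℕ → ℚ) : (polyLang G).Structure (EhrPoly G c) where
  funMap := fun f => nomatch f
  RelMap := fun {_} r => match r with
    | PolyRel.lt => fun a => (a 0).1 < (a 1).1
    | PolyRel.incomp => fun a => ¬ (a 0).1 < (a 1).1 ∧ ¬ (a 1).1 < (a 0).1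
    | PolyRel.const k => fun a => (a 0).1 = c k
    | PolyRel.act g => fun a => (a 0).1 = (a 1).1 ∧ (a 0).2 * g = (a 1).2

/-- The complete theory of the structure above. -/
def ehrPolyTheory (G : Type u) [Group G] (c : ℕ → ℚ) : (polyLang G).Theory :=
  (polyLang G).completeTheory (EhrPoly G c)

end IsolatingFormulas

/-!
The structure on `ℚ × G` is a dense linear order of fibres, each of them a regular `G`-set. A finite
partial map that preserves `<`, the position relative to finitely many `R_k`, and the relations
`Q_g` for `g` in a finite set `F'` extends to any further point, at the price of passing from `F'`
to a smaller set `F`: the first coordinate is chosen by density of `ℚ`, and the second one is either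
forced by a point of the same fibre or chosen far from all of them (`IsLocalIso.exists_insert`).
By back-and-forth the truth value of a formula depends on finitely many of these relations only
(`IsLocalIso.exists_realize_iff`). Since agreement on finitely many formulas can be expressed by a
formula, this carries over from `ℚ × G` to pairs of models of its theory
(`exists_agree_realize_iff`).

Hence an `n`-type is given by the order of its variables, their positions relative to the `R_k`
(two elements of `ℕ ∪ {∞}` for each variable), and for each pair of variables at most one `g` with
`Q_g`. This gives at most `max ℵ₀ |G|` types (`mk_completeType_le`).

The required `1`-type is the type of an element above all `R_k`, which is realized in an ultrapower.
For a realization `a`, the formulas `a < y` and `Q_g(a, y)` are isolating (`arcF_mem_PF`). There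
are no others up to equivalence (`exists_realize_iff_arc`): an isolating formula sees finitely many
`R_k`, so if it could be satisfied by an element below `a`, it would also be satisfied by elements
of some `R_k`. In particular `a < y` is irreversible, while `Q_g` has the inverse `Q_{g⁻¹}`.
Relational composition of these arcs is the multiplication of `G` on the `Q_g`, and `<` absorbs
everything by density (`arc_comp_iff`); this is the operation of the band (`bandOp_arcLabel`).
-/

universe w w'

namespace IsolatingFormulas

/-! ### Finite partial isomorphisms of the structure on `ℚ × G` -/

/-- A finite set of pairs of rationals that preserves `<` extends, in the second coordinate, to any
further first coordinate. -/
theorem exists_insert_order_preserving {O : Set (ℚ × ℚ)} (hO : O.Finite)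
    (h : ∀ p ∈ O, ∀ q ∈ O, p.1 < q.1 ↔ p.2 < q.2) (x : ℚ) :
    ∃ x', ∀ p ∈ insert (x, x') O, ∀ q ∈ insert (x, x') O, p.1 < q.1 ↔ p.2 < q.2 := by
  classical
  suffices H : ∃ x', ∀ p ∈ O, (p.1 < x ↔ p.2 < x') ∧ (x < p.1 ↔ x' < p.2) by
    obtain ⟨x', hx'⟩ := H
    refine ⟨x', ?_⟩
    rintro p (rfl | hp) q (rfl | hq)
    · simp
    · exact (hx' q hq).2
    · exact (hx' p hp).1
    · exact h p hp q hq
  by_cases hx : ∃ p ∈ O, p.1 = x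
  · obtain ⟨p, hp, rfl⟩ := hx
    exact ⟨p.2, fun q hq => ⟨h q hq p hp, h p hp q hq⟩⟩
  · push Not at hx
    obtain ⟨x', h₁, h₂⟩ := Order.exists_between_finsets
      ((hO.toFinset.filter fun p => p.1 < x).image Prod.snd)
      ((hO.toFinset.filter fun p => x < p.1).image Prod.snd) (by
        simp only [Finset.mem_image, Finset.mem_filter, Set.Finite.mem_toFinset]
        rintro _ ⟨p, ⟨hp, hpx⟩, rfl⟩ _ ⟨q, ⟨hq, hqx⟩, rfl⟩
        exact (h p hp q hq).1 (hpx.trans hqx))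
    simp only [Finset.mem_image, Finset.mem_filter, Set.Finite.mem_toFinset] at h₁ h₂
    refine ⟨x', fun p hp => ?_⟩
    rcases lt_or_gt_of_ne (hx p hp) with hlt | hgt
    · have := h₁ _ ⟨p, ⟨hp, hlt⟩, rfl⟩
      exact ⟨iff_of_true hlt this, iff_of_false hlt.not_gt this.not_gt⟩
    · have := h₂ _ ⟨p, ⟨hp, hgt⟩, rfl⟩
      exact ⟨iff_of_false hgt.not_gt this.not_gt, iff_of_true hgt this⟩

section PartialIso

variable {G : Type u} [Group G] {c : ℕ → ℚ}

/-- The pairs of rationals that a set `R` of pairs of points of `ℚ × G` induces, together with the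
diagonal pairs at the first `K` distinguished rationals. -/
def positionPairs (K : ℕ) (R : Set (EhrPoly G c × EhrPoly G c)) : Set (ℚ × ℚ) :=
  (fun p => (p.1.1, p.2.1)) '' R ∪ (fun k => (c k, c k)) '' Set.Iio K

/-- `R` is a partial isomorphism of the reduct of the structure to `<`, the position relative to
`c k` for `k < K`, and the relations `Q_g` for `g ∈ F`. -/
structure IsLocalIso (K : ℕ) (F : Set G) (R : Set (EhrPoly G c × EhrPoly G c)) : Prop where
  order : ∀ p ∈ positionPairs K R, ∀ q ∈ positionPairs K R, p.1 < q.1 ↔ p.2 < q.2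
  act : ∀ p ∈ R, ∀ q ∈ R, ∀ g ∈ F,
    (p.1.1 = q.1.1 ∧ p.1.2 * g = q.1.2) ↔ (p.2.1 = q.2.1 ∧ p.2.2 * g = q.2.2)

namespace IsLocalIso

variable {K K' : ℕ} {F F' : Set G} {R : Set (EhrPoly G c × EhrPoly G c)}

theorem mono (h : IsLocalIso K' F' R) (hK : K ≤ K') (hF : F ⊆ F') : IsLocalIso K F R := by
  have hs : positionPairs K R ⊆ positionPairs K' R :=
    Set.union_subset_union_right _ (Set.image_mono (Set.Iio_subset_Iio hK))
  exact ⟨fun p hp q hq => h.order p (hs hp) q (hs hq),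
    fun p hp q hq g hg => h.act p hp q hq g (hF hg)⟩

theorem swap (h : IsLocalIso K F R) : IsLocalIso K F (Prod.swap '' R) := by
  refine ⟨?_, ?_⟩
  · rintro _ (⟨_, ⟨p, hp, rfl⟩, rfl⟩ | ⟨k, hk, rfl⟩) _ (⟨_, ⟨q, hq, rfl⟩, rfl⟩ | ⟨l, hl, rfl⟩)
    · exact (h.order _ (Or.inl ⟨p, hp, rfl⟩) _ (Or.inl ⟨q, hq, rfl⟩)).symm
    · exact (h.order _ (Or.inl ⟨p, hp, rfl⟩) _ (Or.inr ⟨l, hl, rfl⟩)).symm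
    · exact (h.order _ (Or.inr ⟨k, hk, rfl⟩) _ (Or.inl ⟨q, hq, rfl⟩)).symm
    · exact Iff.rfl
  · rintro _ ⟨p, hp, rfl⟩ _ ⟨q, hq, rfl⟩ g hg
    exact (h.act p hp q hq g hg).symm

theorem lt_iff (h : IsLocalIso K F R) {p q : EhrPoly G c × EhrPoly G c} (hp : p ∈ R) (hq : q ∈ R) :
    p.1.1 < q.1.1 ↔ p.2.1 < q.2.1 :=
  h.order _ (Or.inl ⟨p, hp, rfl⟩) _ (Or.inl ⟨q, hq, rfl⟩)

theorem fst_eq_const_iff (h : IsLocalIso K F R) {p : EhrPoly G c × EhrPoly G c} (hp : p ∈ R)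
    {k : ℕ} (hk : k < K) : p.1.1 = c k ↔ p.2.1 = c k := by
  have h₁ := h.order _ (Or.inl ⟨p, hp, rfl⟩) _ (Or.inr ⟨k, hk, rfl⟩)
  have h₂ := h.order _ (Or.inr ⟨k, hk, rfl⟩) _ (Or.inl ⟨p, hp, rfl⟩)
  simp only at h₁ h₂
  rw [← not_iff_not, ← Ne, ← Ne, ne_iff_lt_or_gt, ne_iff_lt_or_gt, h₁, h₂]

/-- The choice of the `G`-coordinate in the extension step. If `S` relates `x` to a point of `R`, the
choice is forced. Otherwise the new point is chosen far, with respect to `S`, from all points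
already present in its fibre; for finite `G`, where `S` is the whole group, there are none. -/
theorem exists_act_extension {S F' : Set G} (hS : S.Finite)
    (hSG : Infinite G ∨ S = Set.univ) (hF' : ∀ g ∈ S, ∀ h ∈ S, g * h⁻¹ ∈ F')
    (hR : R.Finite) (h : IsLocalIso K F' R) (x : EhrPoly G c) (q' : ℚ)
    (hq' : ∀ p ∈ R, p.1.1 = x.1 ↔ p.2.1 = q') :
    ∃ y : G, ∀ p ∈ R, ∀ g ∈ S,
      (p.1.1 = x.1 ∧ p.1.2 * g = x.2) ↔ (p.2.1 = q' ∧ p.2.2 * g = y) := by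
  by_cases hx : ∃ p ∈ R, p.1.1 = x.1 ∧ ∃ g ∈ S, p.1.2 * g = x.2
  · obtain ⟨p, hp, hpx, g, hg, hgx⟩ := hx
    refine ⟨p.2.2 * g, fun r hr k hk => ?_⟩
    have := h.act r hr p hp _ (hF' k hk g hg)
    rw [← hgx, ← hpx]
    rw [← mul_assoc, ← mul_assoc, mul_inv_eq_iff_eq_mul, mul_inv_eq_iff_eq_mul] at this
    rwa [← (hq' p hp).1 hpx]
  · have hy : ∃ y : G, ∀ p ∈ R, p.2.1 = q' → ∀ g ∈ S, p.2.2 * g ≠ y := by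
      rcases hSG with hG | rfl
      · obtain ⟨y, hy⟩ := ((hR.prod hS).image fun a => a.1.2.2 * a.2).exists_notMem
        exact ⟨y, fun p hp _ g hg e => hy ⟨(p, g), ⟨hp, hg⟩, e⟩⟩
      · refine ⟨1, fun p hp hpq => absurd ⟨p, hp, (hq' p hp).2 hpq, ?_⟩ hx⟩
        exact ⟨p.1.2⁻¹ * x.2, trivial, mul_inv_cancel_left _ _⟩
    obtain ⟨y, hy⟩ := hy
    refine ⟨y, fun p hp g hg => iff_of_false ?_ ?_⟩
    · exact fun e => hx ⟨p, hp, e.1, g, hg, e.2⟩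
    · exact fun e => hy p hp e.1 g hg e.2

/-- The forth condition: a finite partial isomorphism for a large enough finite set `F'` of group
elements extends to any further point as a partial isomorphism for `F`. -/
theorem exists_insert (hF : F.Finite) : ∃ F' : Set G, F'.Finite ∧ F ⊆ F' ∧
    ∀ (K : ℕ) (R : Set (EhrPoly G c × EhrPoly G c)), R.Finite → IsLocalIso K F' R →
      ∀ x, ∃ x', IsLocalIso K F (insert (x, x') R) := by
  obtain ⟨S, hS, hFS, hSinv, hSG⟩ : ∃ S : Set G, S.Finite ∧ F ⊆ S ∧ (∀ g ∈ S, g⁻¹ ∈ S) ∧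
      (Infinite G ∨ S = Set.univ) := by
    rcases finite_or_infinite G with hG | hG
    · exact ⟨Set.univ, Set.finite_univ, Set.subset_univ _, fun _ _ => trivial, Or.inr rfl⟩
    · refine ⟨F ∪ F⁻¹, hF.union hF.inv, Set.subset_union_left, ?_, Or.inl hG⟩
      rintro g (hg | hg)
      · exact Or.inr (by simpa using hg)
      · exact Or.inl hg
  refine ⟨S ∪ Set.image2 (fun g h => g * h⁻¹) S S, hS.union (hS.image2 _ hS),
    hFS.trans Set.subset_union_left, fun K R hR h x => ?_⟩
  have hpos : (positionPairs K R).Finite := (hR.image _).union ((Set.finite_Iio K).image _)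
  obtain ⟨q', hq'⟩ := exists_insert_order_preserving hpos h.order x.1
  have hlt : ∀ p ∈ R, (p.1.1 < x.1 ↔ p.2.1 < q') ∧ (x.1 < p.1.1 ↔ q' < p.2.1) := fun p hp =>
    ⟨hq' _ (Or.inr (Or.inl ⟨p, hp, rfl⟩)) _ (Or.inl rfl),
      hq' _ (Or.inl rfl) _ (Or.inr (Or.inl ⟨p, hp, rfl⟩))⟩
  obtain ⟨y, hy⟩ := exists_act_extension hS hSG
    (fun g hg k hk => Or.inr ⟨g, hg, k, hk, rfl⟩) hR h x q' fun p hp => by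
      rw [← not_iff_not, ← Ne, ← Ne, ne_iff_lt_or_gt, ne_iff_lt_or_gt, (hlt p hp).1, (hlt p hp).2]
  obtain ⟨x', rfl, rfl⟩ : ∃ x' : EhrPoly G c, x'.1 = q' ∧ x'.2 = y := ⟨(q', y), rfl, rfl⟩
  refine ⟨x', ?_, ?_⟩
  · have e : positionPairs K (insert (x, x') R) = insert (x.1, x'.1) (positionPairs K R) :=
      (congrArg (· ∪ _) Set.image_insert_eq).trans Set.insert_union
    rwa [e]
  · rintro p (rfl | hp) r (rfl | hr) g hg
    · simp
    · -- `x * g = r` is `r * g⁻¹ = x`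
      have := hy r hr g⁻¹ (hSinv g (hFS hg))
      rw [mul_inv_eq_iff_eq_mul, mul_inv_eq_iff_eq_mul] at this
      simpa only [eq_comm] using this
    · exact hy p hp g (hFS hg)
    · exact h.act p hp r hr g (Or.inl (hFS hg))

/-- The back-and-forth argument: the truth value of a formula is invariant under finite partial
isomorphisms of some reduct to finitely many relations. -/
theorem exists_realize_iff {α : Type*} {n : ℕ} (φ : (polyLang G).BoundedFormula α n) :
    ∃ (K : ℕ) (F : Set G), F.Finite ∧
      ∀ R : Set (EhrPoly G c × EhrPoly G c), R.Finite → IsLocalIso K F R →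
        ∀ (v v' : α → EhrPoly G c) (xs xs' : Fin n → EhrPoly G c),
          (∀ i, (v i, v' i) ∈ R) → (∀ i, (xs i, xs' i) ∈ R) →
            (φ.Realize v xs ↔ φ.Realize v' xs') := by
  have term_mem : ∀ {n : ℕ} (t : (polyLang G).Term (α ⊕ Fin n))
      (R : Set (EhrPoly G c × EhrPoly G c)) (v v' : α → EhrPoly G c)
      (xs xs' : Fin n → EhrPoly G c), (∀ i, (v i, v' i) ∈ R) → (∀ i, (xs i, xs' i) ∈ R) →
        (t.realize (Sum.elim v xs), t.realize (Sum.elim v' xs')) ∈ R := by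
    intro n t R v v' xs xs' hv hxs
    cases t with
    | var i => cases i with
      | inl i => exact hv i
      | inr i => exact hxs i
    | func f _ => exact f.elim
  induction φ with
  | falsum => exact ⟨0, ∅, Set.finite_empty, fun _ _ _ _ _ _ _ _ _ => Iff.rfl⟩
  | equal t₁ t₂ =>
    refine ⟨0, {1}, Set.finite_singleton 1, fun R _ hR v v' xs xs' hv hxs => ?_⟩
    have := hR.act _ (term_mem t₁ R v v' xs xs' hv hxs) _ (term_mem t₂ R v v' xs xs' hv hxs) 1 rfl
    rw [mul_one, mul_one] at this
    exact Prod.ext_iff.trans (this.trans Prod.ext_iff.symm)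
  | rel r ts =>
    cases r with
    | lt =>
      refine ⟨0, ∅, Set.finite_empty, fun R _ hR v v' xs xs' hv hxs => ?_⟩
      exact hR.lt_iff (term_mem (ts 0) R v v' xs xs' hv hxs) (term_mem (ts 1) R v v' xs xs' hv hxs)
    | incomp =>
      refine ⟨0, ∅, Set.finite_empty, fun R _ hR v v' xs xs' hv hxs => ?_⟩
      have h₀ := term_mem (ts 0) R v v' xs xs' hv hxs
      have h₁ := term_mem (ts 1) R v v' xs xs' hv hxs
      exact and_congr (not_congr (hR.lt_iff h₀ h₁)) (not_congr (hR.lt_iff h₁ h₀))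
    | const k =>
      refine ⟨k + 1, ∅, Set.finite_empty, fun R _ hR v v' xs xs' hv hxs => ?_⟩
      exact hR.fst_eq_const_iff (term_mem (ts 0) R v v' xs xs' hv hxs) k.lt_succ_self
    | act g =>
      refine ⟨0, {g}, Set.finite_singleton g, fun R _ hR v v' xs xs' hv hxs => ?_⟩
      exact hR.act _ (term_mem (ts 0) R v v' xs xs' hv hxs) _
        (term_mem (ts 1) R v v' xs xs' hv hxs) g rfl
  | imp φ ψ ihφ ihψ =>
    obtain ⟨K₁, F₁, hF₁, h₁⟩ := ihφ
    obtain ⟨K₂, F₂, hF₂, h₂⟩ := ihψ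
    refine ⟨max K₁ K₂, F₁ ∪ F₂, hF₁.union hF₂, fun R hfin hR v v' xs xs' hv hxs => ?_⟩
    exact imp_congr
      (h₁ R hfin (hR.mono (le_max_left _ _) Set.subset_union_left) v v' xs xs' hv hxs)
      (h₂ R hfin (hR.mono (le_max_right _ _) Set.subset_union_right) v v' xs xs' hv hxs)
  | all φ ih =>
    obtain ⟨K, F, hF, h⟩ := ih
    obtain ⟨F', hF', -, hext⟩ := exists_insert (c := c) hF
    have key : ∀ R : Set (EhrPoly G c × EhrPoly G c), R.Finite → IsLocalIso K F' R →
        ∀ (v v' : α → EhrPoly G c) xs xs', (∀ i, (v i, v' i) ∈ R) → (∀ i, (xs i, xs' i) ∈ R) →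
          φ.all.Realize v' xs' → φ.all.Realize v xs := by
      intro R hfin hR v v' xs xs' hv hxs H x
      obtain ⟨x', hx'⟩ := hext K R hfin hR x
      refine (h _ (hfin.insert _) hx' v v' _ (Fin.snoc xs' x') (fun i => Or.inr (hv i))
        fun i => ?_).2 (H x')
      refine Fin.lastCases ?_ (fun j => ?_) i
      · simp
      · simpa using Or.inr (hxs j)
    refine ⟨K, F', hF', fun R hfin hR v v' xs xs' hv hxs => ⟨?_, key R hfin hR v v' xs xs' hv hxs⟩⟩
    exact key _ (hfin.image _) hR.swap v' v xs' xs (fun i => ⟨_, hv i, rfl⟩)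
      fun i => ⟨_, hxs i, rfl⟩

end IsLocalIso

end PartialIso

/-! ### Transfer between a structure and the models of its complete theory -/

section Transfer

variable {L : FirstOrder.Language} {M N P ι : Type*} [L.Structure M] [L.Structure N]
  [L.Structure P] [N ⊨ L.completeTheory M]

open Classical in
theorem realize_iInf_ite {D : Type*} [Finite D] (δ : D → L.Formula ι) (V : D → Prop) (s : ι → P) :
    (Formula.iInf fun d => if V d then δ d else ∼(δ d)).Realize s ↔
      ∀ d, (δ d).Realize s ↔ V d := by
  rw [Formula.realize_iInf]
  refine forall_congr' fun d => ?_
  split_ifs with h <;> simp [h]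

theorem realize_iExs_relabel_inr [Finite ι] (χ : L.Formula ι) :
    P ⊨ (Formula.iExs ι (χ.relabel (Sum.inr : ι → Empty ⊕ ι)) : L.Sentence) ↔
      ∃ s : ι → P, χ.Realize s := by
  simp [Sentence.Realize, Formula.realize_iExs, Formula.realize_relabel, Function.comp_def]

variable (M) in
/-- A tuple of a model of the complete theory of `M` can be imitated in `M` with respect to finitely
many formulas. -/
theorem exists_forall_realize_iff [Finite ι] {D : Type*} [Finite D] (δ : D → L.Formula ι)
    (t : ι → N) :
    ∃ s : ι → M, ∀ d, (δ d).Realize s ↔ (δ d).Realize t := by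
  obtain ⟨s, hs⟩ := (realize_iExs_relabel_inr _).1
    ((realize_iff_of_model_completeTheory M N _).1 ((realize_iExs_relabel_inr _).2
      ⟨t, (realize_iInf_ite δ (fun d => (δ d).Realize t) t).2 fun _ => Iff.rfl⟩))
  exact ⟨s, (realize_iInf_ite δ _ s).1 hs⟩

/-- A formula that is valid in `M` is valid in every model of the complete theory of `M`. -/
theorem realize_of_forall_realize [Finite ι] (φ : L.Formula ι) (h : ∀ s : ι → M, φ.Realize s)
    (t : ι → N) : φ.Realize t :=
  have ⟨s, hs⟩ := exists_forall_realize_iff M (fun _ : Unit => φ) t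
  (hs ()).1 (h s)

end Transfer

/-! ### The basic relations in models of the theory -/

section Relations

variable {G : Type u} {N : Type*} [(polyLang G).Structure N] {ι : Type*}

variable (G) in
/-- The relation `<` of a structure. -/
def Lt (a b : N) : Prop :=
  Structure.RelMap (L := polyLang G) (PolyRel.lt : (polyLang G).Relations 2) ![a, b]

/-- The relation `Q_g` of a structure. -/
def Act (g : G) (a b : N) : Prop :=
  Structure.RelMap (L := polyLang G) (PolyRel.act g : (polyLang G).Relations 2) ![a, b]

variable (G) in
/-- The predicate `R_k` of a structure. -/
def Const (k : ℕ) (a : N) : Prop :=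
  Structure.RelMap (L := polyLang G) (PolyRel.const k : (polyLang G).Relations 1) ![a]

variable (G) in
/-- `a` lies below the elements of `R_k`. -/
def Below (k : ℕ) (a : N) : Prop := ∃ z, Const G k z ∧ Lt G a z

variable (G) in
/-- `a` lies above the elements of `R_k`. -/
def Above (k : ℕ) (a : N) : Prop := ∃ z, Const G k z ∧ Lt G z a

/-- The relations that will turn out to be the principal arcs between realizations of the type at
infinity: `none` stands for `<` and `some g` for `Q_g`. -/
def Arc : Option G → N → N → Prop
  | none => Lt G
  | some g => Act g

variable (G) in
/-- The formula `x_i < x_j`. -/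
def ltF (i j : ι) : (polyLang G).Formula ι :=
  Relations.formula₂ (PolyRel.lt : (polyLang G).Relations 2) (Term.var i) (Term.var j)

/-- The formula `Q_g(x_i, x_j)`. -/
def actF (g : G) (i j : ι) : (polyLang G).Formula ι :=
  Relations.formula₂ (PolyRel.act g : (polyLang G).Relations 2) (Term.var i) (Term.var j)

variable (G) in
/-- The formula `R_k(x_i)`. -/
def constF (k : ℕ) (i : ι) : (polyLang G).Formula ι :=
  Relations.formula₁ (PolyRel.const k : (polyLang G).Relations 1) (Term.var i)

variable (G) in
/-- The formula `∃ z, R_k(z) ∧ x_i < z`. -/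
noncomputable def belowF (k : ℕ) (i : ι) : (polyLang G).Formula ι :=
  Formula.iExs Unit (constF G k (Sum.inr ()) ⊓ ltF G (Sum.inl i) (Sum.inr ()))

variable (G) in
/-- The formula `∃ z, R_k(z) ∧ z < x_i`. -/
noncomputable def aboveF (k : ℕ) (i : ι) : (polyLang G).Formula ι :=
  Formula.iExs Unit (constF G k (Sum.inr ()) ⊓ ltF G (Sum.inr ()) (Sum.inl i))

/-- The formula that defines `Arc o`. -/
def arcF : Option G → ι → ι → (polyLang G).Formula ι
  | none, i, j => ltF G i j
  | some g, i, j => actF g i j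

@[simp] theorem realize_ltF (i j : ι) (t : ι → N) : (ltF G i j).Realize t ↔ Lt G (t i) (t j) :=
  Formula.realize_rel₂

@[simp] theorem realize_actF (g : G) (i j : ι) (t : ι → N) :
    (actF g i j).Realize t ↔ Act g (t i) (t j) :=
  Formula.realize_rel₂

@[simp] theorem realize_constF (k : ℕ) (i : ι) (t : ι → N) :
    (constF G k i).Realize t ↔ Const G k (t i) :=
  Formula.realize_rel₁

@[simp] theorem realize_belowF (k : ℕ) (i : ι) (t : ι → N) :
    (belowF G k i).Realize t ↔ Below G k (t i) := by
  simp only [belowF, Formula.realize_iExs, Formula.realize_inf, realize_constF, realize_ltF]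
  exact ⟨fun ⟨z, hz⟩ => ⟨z (), hz⟩, fun ⟨z, hz⟩ => ⟨fun _ => z, hz⟩⟩

@[simp] theorem realize_aboveF (k : ℕ) (i : ι) (t : ι → N) :
    (aboveF G k i).Realize t ↔ Above G k (t i) := by
  simp only [aboveF, Formula.realize_iExs, Formula.realize_inf, realize_constF, realize_ltF]
  exact ⟨fun ⟨z, hz⟩ => ⟨z (), hz⟩, fun ⟨z, hz⟩ => ⟨fun _ => z, hz⟩⟩

@[simp] theorem realize_arcF (o : Option G) (i j : ι) (t : ι → N) :
    (arcF o i j).Realize t ↔ Arc o (t i) (t j) := by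
  cases o
  · exact realize_ltF i j t
  · exact realize_actF _ i j t

end Relations

/-! ### Elementary properties of the models -/

section Models

variable {G : Type u} [Group G] {c : ℕ → ℚ}

instance : Nonempty (EhrPoly G c) := ⟨((0, 1) : ℚ × G)⟩

theorem lt_iff {a b : EhrPoly G c} : Lt G a b ↔ a.1 < b.1 := Iff.rfl

theorem act_iff {g : G} {a b : EhrPoly G c} : Act g a b ↔ a.1 = b.1 ∧ a.2 * g = b.2 := Iff.rfl

theorem const_iff {k : ℕ} {a : EhrPoly G c} : Const G k a ↔ a.1 = c k := Iff.rfl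

theorem below_iff {k : ℕ} {a : EhrPoly G c} : Below G k a ↔ a.1 < c k :=
  ⟨fun ⟨_, hz, h⟩ => (const_iff.1 hz) ▸ lt_iff.1 h,
    fun h => ⟨((c k, 1) : ℚ × G), const_iff.2 rfl, lt_iff.2 h⟩⟩

theorem above_iff {k : ℕ} {a : EhrPoly G c} : Above G k a ↔ c k < a.1 :=
  ⟨fun ⟨_, hz, h⟩ => (const_iff.1 hz) ▸ lt_iff.1 h,
    fun h => ⟨((c k, 1) : ℚ × G), const_iff.2 rfl, lt_iff.2 h⟩⟩

/-- The composition of the relations `Arc`. -/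
def Arc.comp : Option G → Option G → Option G
  | some g, some h => some (g * h)
  | _, _ => none

variable {N : Type*} [(polyLang G).Structure N]

variable (c) [N ⊨ ehrPolyTheory G c]

theorem realize_of_valid {ι : Type*} [Finite ι] (φ : (polyLang G).Formula ι)
    (h : ∀ s : ι → EhrPoly G c, φ.Realize s) (t : ι → N) : φ.Realize t :=
  have : N ⊨ (polyLang G).completeTheory (EhrPoly G c) := ‹N ⊨ ehrPolyTheory G c›
  realize_of_forall_realize φ h t

theorem realize_pair_of_valid (φ : (polyLang G).Formula (Fin 2))
    (h : ∀ a b : EhrPoly G c, φ.Realize ![a, b]) (a b : N) : φ.Realize ![a, b] :=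
  realize_of_valid c φ (fun s => by
    have e : s = ![s 0, s 1] := funext fun i => by fin_cases i <;> rfl
    exact e ▸ h (s 0) (s 1)) _

include c

theorem lt_trans' {a b d : N} (h₁ : Lt G a b) (h₂ : Lt G b d) : Lt G a d := by
  have := realize_of_valid (N := N) c
    ((ltF G (0 : Fin 3) 1 ⊓ ltF G 1 2).imp (ltF G 0 2))
    (fun s => by
      simp only [Formula.realize_imp, Formula.realize_inf, realize_ltF, lt_iff]
      exact fun h => h.1.trans h.2) ![a, b, d]
  simp only [Formula.realize_imp, Formula.realize_inf, realize_ltF] at this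
  exact this ⟨h₁, h₂⟩

theorem not_arc_of_lt {a b : N} (h : Lt G a b) (o : Option G) : ¬ Arc o b a := by
  have := realize_pair_of_valid (N := N) c
    ((ltF G 0 1).imp (arcF o 1 0).not) (fun a b => by
    simp only [Formula.realize_imp, Formula.realize_not, realize_ltF, realize_arcF, lt_iff]
    intro h h'
    cases o with
    | none => exact lt_asymm h (lt_iff.1 h')
    | some g => exact h.ne' (act_iff.1 h').1) a b
  simp only [Formula.realize_imp, Formula.realize_not, realize_ltF, realize_arcF] at this
  exact this h

theorem arc_unique {a b : N} {o o' : Option G} (h : Arc o a b) (h' : Arc o' a b) : o = o' := by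
  by_contra hne
  have := realize_pair_of_valid (N := N) c
    ((arcF o 0 1).imp (arcF o' 0 1).not) (fun a b => by
    simp only [Formula.realize_imp, Formula.realize_not, realize_arcF]
    intro h h'
    cases o with
    | none =>
      cases o' with
      | none => exact hne rfl
      | some g => exact (lt_iff.1 h).ne (act_iff.1 h').1
    | some g =>
      cases o' with
      | none => exact (lt_iff.1 h').ne (act_iff.1 h).1
      | some g' =>
        exact hne (congrArg some (mul_left_cancel ((act_iff.1 h).2.trans (act_iff.1 h').2.symm))))
    a b
  simp only [Formula.realize_imp, Formula.realize_not, realize_arcF] at this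
  exact this h h'

theorem act_one_iff {a b : N} : Act (1 : G) a b ↔ a = b := by
  have := realize_pair_of_valid (N := N) c
    ((actF (1 : G) 0 1).iff (Term.equal (Term.var 0) (Term.var 1)))
    (fun a b => by
      simp only [Formula.realize_iff, realize_actF, Formula.realize_equal, Term.realize_var,
        act_iff, mul_one]
      exact Prod.ext_iff.symm) a b
  simpa [Formula.realize_iff, Formula.realize_equal] using this

theorem act_inv {g : G} {a b : N} (h : Act g a b) : Act g⁻¹ b a := by
  have := realize_pair_of_valid (N := N) c
    ((actF g 0 1).imp (actF g⁻¹ 1 0)) (fun a b => by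
    simp only [Formula.realize_imp, realize_actF, act_iff]
    exact fun h => ⟨h.1.symm, mul_inv_eq_of_eq_mul h.2.symm⟩) a b
  simp only [Formula.realize_imp, realize_actF] at this
  exact this h

theorem exists_arc (o : Option G) (a : N) : ∃ b, Arc o a b := by
  have := realize_of_valid (N := N) c
    (Formula.iExs Unit (arcF o (Sum.inl ()) (Sum.inr ())))
    (fun s => by
      simp only [Formula.realize_iExs, realize_arcF]
      cases o with
      | none => exact ⟨fun _ => (((s ()).1 + 1, 1) : ℚ × G), lt_iff.2 (lt_add_one (s ()).1)⟩
      | some g => exact ⟨fun _ => (((s ()).1, (s ()).2 * g) : ℚ × G), act_iff.2 ⟨rfl, rfl⟩⟩)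
    fun _ => a
  simp only [Formula.realize_iExs, realize_arcF] at this
  obtain ⟨z, hz⟩ := this
  exact ⟨z (), hz⟩

/-- The product of two arcs is an arc: `<` is dense and absorbs the relations `Q_g`, and `Q_g`
followed by `Q_h` is `Q_{gh}`. -/
theorem arc_comp_iff (o o' : Option G) (a b : N) :
    Arc (Arc.comp o o') a b ↔ ∃ z, Arc o a z ∧ Arc o' z b := by
  have := realize_pair_of_valid (N := N) c
    ((arcF (Arc.comp o o') 0 1).iff
    (Formula.iExs Unit (arcF o (Sum.inl 0) (Sum.inr ()) ⊓ arcF o' (Sum.inr ()) (Sum.inl 1))))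
    (fun a b => by
      simp only [Formula.realize_iff, Formula.realize_iExs, Formula.realize_inf, realize_arcF]
      constructor
      · intro h
        cases o with
        | none =>
          cases o' with
          | none =>
            obtain ⟨q, hq₁, hq₂⟩ := exists_between (lt_iff.1 h)
            exact ⟨fun _ => ((q, 1) : ℚ × G), lt_iff.2 hq₁, lt_iff.2 hq₂⟩
          | some g =>
            exact ⟨fun _ => ((b.1, b.2 * g⁻¹) : ℚ × G), h,
              act_iff.2 ⟨rfl, inv_mul_cancel_right b.2 g⟩⟩
        | some g =>
          refine ⟨fun _ => ((a.1, a.2 * g) : ℚ × G), act_iff.2 ⟨rfl, rfl⟩, ?_⟩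
          cases o' with
          | none => exact h
          | some g' => exact act_iff.2 ⟨(act_iff.1 h).1, (mul_assoc _ _ _).trans (act_iff.1 h).2⟩
      · rintro ⟨z, h₁, h₂⟩
        cases o with
        | none =>
          cases o' with
          | none => exact lt_iff.2 ((lt_iff.1 h₁).trans (lt_iff.1 h₂))
          | some g => exact lt_iff.2 ((lt_iff.1 h₁).trans_eq (act_iff.1 h₂).1)
        | some g =>
          cases o' with
          | none => exact lt_iff.2 ((act_iff.1 h₁).1.trans_lt (lt_iff.1 h₂))
          | some g' =>
            exact act_iff.2 ⟨(act_iff.1 h₁).1.trans (act_iff.1 h₂).1,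
              ((mul_assoc _ _ _).symm.trans (congrArg (· * g') (act_iff.1 h₁).2)).trans
                (act_iff.1 h₂).2⟩) a b
  simp only [Formula.realize_iff, Formula.realize_iExs, Formula.realize_inf, realize_arcF] at this
  exact this.trans ⟨fun ⟨z, hz⟩ => ⟨z (), hz⟩, fun ⟨z, hz⟩ => ⟨fun _ => z, hz⟩⟩

theorem not_below_of_above {k : ℕ} {a : N} (h : Above G k a) : ¬ Below G k a := by
  have := realize_of_valid (N := N) c
    ((aboveF G k ()).imp (belowF G k ()).not)
    (fun s => by
      simp only [Formula.realize_imp, Formula.realize_not, realize_aboveF, realize_belowF,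
        above_iff, below_iff]
      exact lt_asymm) fun _ => a
  simp only [Formula.realize_imp, Formula.realize_not, realize_aboveF, realize_belowF] at this
  exact this h

theorem above_of_arc {k : ℕ} {a b : N} {o : Option G} (h : Above G k a) (hab : Arc o a b) :
    Above G k b := by
  have := realize_pair_of_valid (N := N) c
    ((aboveF G k 0 ⊓ arcF o 0 1).imp (aboveF G k 1)) (fun a b => by
    simp only [Formula.realize_imp, Formula.realize_inf, realize_aboveF, realize_arcF]
    rintro ⟨h, hab⟩
    rw [above_iff] at h ⊢
    cases o with
    | none => exact h.trans (lt_iff.1 hab)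
    | some g => exact h.trans_eq (act_iff.1 hab).1) a b
  simp only [Formula.realize_imp, Formula.realize_inf, realize_aboveF, realize_arcF] at this
  exact this ⟨h, hab⟩

theorem not_above_of_const {k : ℕ} {a : N} (h : Const G k a) : ¬ Above G k a := by
  have := realize_of_valid (N := N) c
    ((constF G k ()).imp (aboveF G k ()).not)
    (fun s => by
      simp only [Formula.realize_imp, Formula.realize_not, realize_aboveF, realize_constF,
        above_iff, const_iff]
      exact fun h => h.not_gt) fun _ => a
  simp only [Formula.realize_imp, Formula.realize_not, realize_aboveF, realize_constF] at this
  exact this h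

theorem above_of_const (hc : StrictMono c) {k l : ℕ} (hkl : k < l) {a : N} (h : Const G l a) :
    Above G k a := by
  have := realize_of_valid (N := N) c
    ((constF G l ()).imp (aboveF G k ()))
    (fun s => by
      simp only [Formula.realize_imp, realize_aboveF, realize_constF, above_iff, const_iff]
      exact fun h => h ▸ hc hkl) fun _ => a
  simp only [Formula.realize_imp, realize_aboveF, realize_constF] at this
  exact this h

theorem below_mono (hc : StrictMono c) {k l : ℕ} (hkl : k ≤ l) {a : N} (h : Below G k a) :
    Below G l a := by
  have := realize_of_valid (N := N) c
    ((belowF G k ()).imp (belowF G l ()))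
    (fun s => by
      simp only [Formula.realize_imp, realize_belowF, below_iff]
      exact fun h => h.trans_le (hc.monotone hkl)) fun _ => a
  simp only [Formula.realize_imp, realize_belowF] at this
  exact this h

theorem above_anti (hc : StrictMono c) {k l : ℕ} (hkl : k ≤ l) {a : N} (h : Above G l a) :
    Above G k a := by
  have := realize_of_valid (N := N) c
    ((aboveF G l ()).imp (aboveF G k ()))
    (fun s => by
      simp only [Formula.realize_imp, realize_aboveF, above_iff]
      exact fun h => (hc.monotone hkl).trans_lt h) fun _ => a
  simp only [Formula.realize_imp, realize_aboveF] at this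
  exact this h

end Models

theorem infinite_of_model {G : Type u} [Group G] (c : ℕ → ℚ) (N : Type*)
    [(polyLang G).Structure N] [N ⊨ ehrPolyTheory G c] [Nonempty N] : Infinite N := by
  let _ : PartialOrder N :=
    @partialOrderOfSO N (Lt G)
      { irrefl := fun a h => not_arc_of_lt c h none h
        trans := fun _ _ _ => lt_trans' c }
  have : NoMaxOrder N := ⟨fun a => exists_arc c (none : Option G) a⟩
  exact NoMaxOrder.infinite

/-! ### Types are determined by the basic relations -/

section Agreement

variable {G : Type u} {N N' N'' ι κ : Type*} [(polyLang G).Structure N] [(polyLang G).Structure N']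
  [(polyLang G).Structure N'']

/-- The tuples `t` and `t'` agree on `<`, on the position relative to `R_k` for `k < K`, and on
`Q_g` for `g ∈ F`. -/
structure Agree (K : ℕ) (F : Set G) (t : ι → N) (t' : ι → N') : Prop where
  lt : ∀ i j, Lt G (t i) (t j) ↔ Lt G (t' i) (t' j)
  below : ∀ k < K, ∀ i, Below G k (t i) ↔ Below G k (t' i)
  above : ∀ k < K, ∀ i, Above G k (t i) ↔ Above G k (t' i)
  act : ∀ g ∈ F, ∀ i j, Act g (t i) (t j) ↔ Act g (t' i) (t' j)

theorem Agree.comp {K : ℕ} {F : Set G} {t : ι → N} {t' : ι → N'} (h : Agree K F t t')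
    (e : κ → ι) : Agree K F (t ∘ e) (t' ∘ e) :=
  ⟨fun i j => h.lt (e i) (e j), fun k hk i => h.below k hk (e i), fun k hk i => h.above k hk (e i),
    fun g hg i j => h.act g hg (e i) (e j)⟩

theorem Agree.symm {K : ℕ} {F : Set G} {t : ι → N} {t' : ι → N'} (h : Agree K F t t') :
    Agree K F t' t :=
  ⟨fun i j => (h.lt i j).symm, fun k hk i => (h.below k hk i).symm,
    fun k hk i => (h.above k hk i).symm, fun g hg i j => (h.act g hg i j).symm⟩

theorem Agree.trans {K : ℕ} {F : Set G} {t : ι → N} {t' : ι → N'} {t'' : ι → N''}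
    (h : Agree K F t t') (h' : Agree K F t' t'') : Agree K F t t'' :=
  ⟨fun i j => (h.lt i j).trans (h'.lt i j), fun k hk i => (h.below k hk i).trans (h'.below k hk i),
    fun k hk i => (h.above k hk i).trans (h'.above k hk i),
    fun g hg i j => (h.act g hg i j).trans (h'.act g hg i j)⟩

variable [Group G]

theorem isLocalIso_range {c : ℕ → ℚ} {K : ℕ} {F : Set G} {s s' : ι → EhrPoly G c}
    (h : Agree K F s s') : IsLocalIso K F (Set.range fun i => (s i, s' i)) := by
  refine ⟨?_, ?_⟩
  · rintro _ (⟨_, ⟨i, rfl⟩, rfl⟩ | ⟨k, hk, rfl⟩) _ (⟨_, ⟨j, rfl⟩, rfl⟩ | ⟨l, hl, rfl⟩)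
    · exact h.lt i j
    · have := h.below l hl i
      rwa [below_iff, below_iff] at this
    · have := h.above k hk j
      rwa [above_iff, above_iff] at this
    · exact Iff.rfl
  · rintro _ ⟨i, rfl⟩ _ ⟨j, rfl⟩ g hg
    exact h.act g hg i j

end Agreement

section Locality

variable {G : Type u} [Group G] (c : ℕ → ℚ) {ι : Type*} [Finite ι]

/-- A tuple of a model can be imitated in `ℚ × G` with respect to one formula and finitely many basic
relations. -/
theorem exists_agree (φ : (polyLang G).Formula ι) (K : ℕ) {F : Set G} (hF : F.Finite)
    {N : Type*} [(polyLang G).Structure N] [hN : N ⊨ ehrPolyTheory G c] (t : ι → N) :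
    ∃ s : ι → EhrPoly G c, Agree K F s t ∧ (φ.Realize s ↔ φ.Realize t) := by
  have : N ⊨ (polyLang G).completeTheory (EhrPoly G c) := hN
  have := hF.to_subtype
  let δ : Unit ⊕ (ι × ι) ⊕ (Fin K × ι) ⊕ (Fin K × ι) ⊕ (F × ι × ι) → (polyLang G).Formula ι :=
    Sum.elim (fun _ => φ) <| Sum.elim (fun p => ltF G p.1 p.2) <|
      Sum.elim (fun p => belowF G p.1 p.2) <| Sum.elim (fun p => aboveF G p.1 p.2) fun p =>
        actF p.1.1 p.2.1 p.2.2
  obtain ⟨s, hs⟩ := exists_forall_realize_iff (EhrPoly G c) δ t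
  exact ⟨s, ⟨fun i j => by simpa [δ] using hs (Sum.inr (Sum.inl (i, j))),
      fun k hk i => by simpa [δ] using hs (Sum.inr (Sum.inr (Sum.inl (⟨k, hk⟩, i)))),
      fun k hk i => by simpa [δ] using hs (Sum.inr (Sum.inr (Sum.inr (Sum.inl (⟨k, hk⟩, i))))),
      fun g hg i j => by
        simpa [δ] using hs (Sum.inr (Sum.inr (Sum.inr (Sum.inr (⟨g, hg⟩, i, j)))))⟩,
    hs (Sum.inl ())⟩

/-- Every formula is determined, in all models of the theory, by finitely many of the relations `<`,
`Below`, `Above` and `Act`. This is quantifier elimination down to these relations. -/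
theorem exists_agree_realize_iff (φ : (polyLang G).Formula ι) :
    ∃ (K : ℕ) (F : Set G), F.Finite ∧ ∀ (N : Type w) [(polyLang G).Structure N]
      [N ⊨ ehrPolyTheory G c] (N' : Type w') [(polyLang G).Structure N']
      [N' ⊨ ehrPolyTheory G c] (t : ι → N) (t' : ι → N'),
      Agree K F t t' → (φ.Realize t ↔ φ.Realize t') := by
  obtain ⟨K, F, hF, h⟩ := IsLocalIso.exists_realize_iff (c := c) φ
  refine ⟨K, F, hF, fun N _ _ N' _ _ t t' ht => ?_⟩
  obtain ⟨s, hs, hφ⟩ := exists_agree c φ K hF t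
  obtain ⟨s', hs', hφ'⟩ := exists_agree c φ K hF t'
  rw [← hφ, ← hφ']
  exact h _ (Set.finite_range _) (isLocalIso_range ((hs.trans ht).trans hs'.symm)) s s' _ _
    (fun i => ⟨i, rfl⟩) fun i => i.elim0

end Locality

/-! ### The number of types -/

section Counting

variable {G : Type u} [Group G] {c : ℕ → ℚ}

theorem typeOf_eq_typeOf_iff {L : FirstOrder.Language} {T : L.Theory} {α : Type*} {M N : Type*}
    [L.Structure M] [Nonempty M] [M ⊨ T] [L.Structure N] [Nonempty N] [N ⊨ T] {s : α → M}
    {t : α → N} : T.typeOf s = T.typeOf t ↔ ∀ φ : L.Formula α, φ.Realize s ↔ φ.Realize t := by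
  constructor
  · intro h φ
    rw [← Theory.CompleteType.formula_mem_typeOf (T := T), h,
      Theory.CompleteType.formula_mem_typeOf]
  · intro h
    refine SetLike.ext fun φ => ?_
    rw [Theory.CompleteType.mem_typeOf, Theory.CompleteType.mem_typeOf]
    exact h _

variable {N N' : Type*} [(polyLang G).Structure N] [(polyLang G).Structure N']

open Classical in
/-- The least `k` with `P k`, if there is one. -/
noncomputable def leastOf (P : ℕ → Prop) : Option ℕ :=
  if h : ∃ k, P k then some (Nat.find h) else none

theorem iff_of_leastOf_eq {P Q : ℕ → Prop} (hP : ∀ k l, k ≤ l → P k → P l)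
    (hQ : ∀ k l, k ≤ l → Q k → Q l) (h : leastOf P = leastOf Q) (k : ℕ) : P k ↔ Q k := by
  classical
  unfold leastOf at h
  split_ifs at h with h₁ h₂ h₂
  · have e := Option.some.inj h
    exact ⟨fun hk => hQ _ _ (e ▸ Nat.find_min' h₁ hk) (Nat.find_spec h₂),
      fun hk => hP _ _ (e.symm ▸ Nat.find_min' h₂ hk) (Nat.find_spec h₁)⟩
  · push Not at h₁ h₂
    exact iff_of_false (h₁ k) (h₂ k)

open Classical in
variable (G) in
/-- The element `g` of the group with `Q_g(a, b)`, if there is one. -/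
noncomputable def actOf (a b : N) : Option G :=
  if h : ∃ g : G, Act g a b then some h.choose else none

variable (c) in
theorem act_iff_actOf_eq [N ⊨ ehrPolyTheory G c] {g : G} {a b : N} :
    Act g a b ↔ actOf G a b = some g := by
  unfold actOf
  split_ifs with h
  · constructor
    · intro hg
      exact arc_unique c (o := some h.choose) (o' := some g) h.choose_spec hg
    · intro e
      exact Option.some.inj e ▸ h.choose_spec
  · exact iff_of_false (fun hg => h ⟨g, hg⟩) (by simp)

/-- The invariants of an `n`-tuple that determine its type: order, position relative to the `R_k`,
and `G`-differences. -/
noncomputable def typeCode {n : ℕ} (t : Fin n → N) :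
    (Fin n → Option ℕ × Option ℕ) × (Fin n → Fin n → Prop × Option G) :=
  (fun i => (leastOf fun k => Below G k (t i), leastOf fun k => ¬ Above G k (t i)),
    fun i j => (Lt G (t i) (t j), actOf G (t i) (t j)))

theorem typeOf_eq_of_typeCode_eq [N ⊨ ehrPolyTheory G c] [N' ⊨ ehrPolyTheory G c]
    [Nonempty N] [Nonempty N'] (hc : StrictMono c) {n : ℕ} {t : Fin n → N} {t' : Fin n → N'}
    (h : typeCode (G := G) t = typeCode t') :
    (ehrPolyTheory G c).typeOf t = (ehrPolyTheory G c).typeOf t' := by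
  refine typeOf_eq_typeOf_iff.2 fun φ => ?_
  obtain ⟨K, F, hF, hKF⟩ := exists_agree_realize_iff c φ
  have h₁ i j := congrFun (congrFun (congrArg Prod.snd h) i) j
  have h₂ i := congrFun (congrArg Prod.fst h) i
  simp only [typeCode, Prod.mk.injEq] at h₁ h₂
  refine hKF N N' t t' ⟨fun i j => iff_of_eq (h₁ i j).1, fun k _ i => ?_, fun k _ i => ?_,
    fun g _ i j => ?_⟩
  · exact iff_of_leastOf_eq (fun _ _ hkl => below_mono c hc hkl)
      (fun _ _ hkl => below_mono c hc hkl) (h₂ i).1 k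
  · exact not_iff_not.1 (iff_of_leastOf_eq (fun k l hkl hk hl => hk (above_anti c hc hkl hl))
      (fun k l hkl hk hl => hk (above_anti c hc hkl hl)) (h₂ i).2 k)
  · rw [act_iff_actOf_eq c, act_iff_actOf_eq c, (h₁ i j).2]

theorem mk_fin_fun_le {X : Type u} {κ : Cardinal.{u}} (hκ : Cardinal.aleph0 ≤ κ)
    (hX : Cardinal.mk X ≤ κ) (n : ℕ) : Cardinal.mk (Fin n → X) ≤ κ := by
  rw [Cardinal.mk_arrow, Cardinal.lift_uzero, Cardinal.mk_fin, Cardinal.lift_natCast]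
  exact (Cardinal.power_le_power_right hX).trans (Cardinal.power_nat_le hκ)

theorem mk_prod_le_of_countable {X : Type u} {Y : Type} [Countable Y] {κ : Cardinal.{u}}
    (hκ : Cardinal.aleph0 ≤ κ) (hX : Cardinal.mk X ≤ κ) : Cardinal.mk (Y × X) ≤ κ := by
  rw [Cardinal.mk_prod, Cardinal.lift_uzero]
  refine (mul_le_mul' ((Cardinal.lift_le_aleph0.2 Cardinal.mk_le_aleph0).trans hκ) hX).trans ?_
  exact (Cardinal.mul_eq_self hκ).le

theorem mk_completeType_le (hc : StrictMono c) {κ : Cardinal.{u}} (hκ : Cardinal.aleph0 ≤ κ)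
    (hG : Cardinal.mk G ≤ κ) (n : ℕ) :
    Cardinal.mk ((ehrPolyTheory G c).CompleteType (Fin n)) ≤ κ := by
  choose M t ht using fun p : (ehrPolyTheory G c).CompleteType (Fin n) =>
    Theory.exists_modelType_is_realized_in _ p
  have hinj : Function.Injective fun p => typeCode (G := G) (t p) := fun p q h => by
    rw [← ht p, ← ht q]
    exact typeOf_eq_of_typeCode_eq hc h
  refine (Cardinal.mk_le_of_injective hinj).trans (mk_prod_le_of_countable hκ ?_)
  refine mk_fin_fun_le hκ (mk_fin_fun_le hκ (mk_prod_le_of_countable hκ ?_) n) n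
  rw [Cardinal.mk_option]
  exact Cardinal.add_le_of_le hκ hG (Cardinal.one_le_aleph0.trans hκ)

end Counting

/-! ### The type at infinity -/

section TypeAtInfinity

variable {G : Type u} [Group G] {c : ℕ → ℚ}

instance : EhrPoly G c ⊨ ehrPolyTheory G c :=
  inferInstanceAs (EhrPoly G c ⊨ (polyLang G).completeTheory (EhrPoly G c))

/-- Some model of the theory has an element above all `R_k`: the class of the sequence
`(c k, 1)` in an ultrapower. -/
theorem exists_forall_above (hc : StrictMono c) :
    ∃ (M : Theory.ModelType.{0, u, u} (ehrPolyTheory G c)) (a : M), ∀ k, Above G k a := by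
  let 𝒰 : Ultrafilter ℕ := Filter.hyperfilter ℕ
  let P := (𝒰 : Filter ℕ).Product fun _ : ℕ => EhrPoly G c
  have hP : P ⊨ ehrPolyTheory G c := by
    refine ⟨fun φ hφ => (Ultraproduct.sentence_realize φ).2 ?_⟩
    exact Filter.Eventually.of_forall fun _ => hφ
  let x : ℕ → EhrPoly G c := fun n => ((c n, 1) : ℚ × G)
  refine ⟨@Theory.ModelType.of _ _ P _ hP _, (x : P), fun k => ?_⟩
  have h := (Ultraproduct.realize_formula_cast (u := 𝒰) (M := fun _ : ℕ => EhrPoly G c)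
    (aboveF G k ()) fun _ => x).2 ?_
  · exact (realize_aboveF k () _).1 h
  · refine Filter.Eventually.filter_mono Nat.hyperfilter_le_atTop ?_
    filter_upwards [Filter.eventually_gt_atTop k] with n hn
    exact (realize_aboveF k () _).2 (above_iff.2 (hc hn))

/-- The type of the elements above all `R_k`. -/
noncomputable def typeAtInfinity (G : Type u) [Group G] {c : ℕ → ℚ} (hc : StrictMono c) :
    (ehrPolyTheory G c).CompleteType (Fin 1) :=
  (ehrPolyTheory G c).typeOf fun _ => (exists_forall_above (G := G) hc).choose_spec.choose

theorem realizes_typeAtInfinity_iff (hc : StrictMono c)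
    {M : Theory.ModelType.{0, u, u} (ehrPolyTheory G c)} {a : M} :
    Realizes (typeAtInfinity G hc) a ↔ ∀ k, Above G k a := by
  have hx := (exists_forall_above (G := G) hc).choose_spec.choose_spec
  rw [Realizes, typeAtInfinity, typeOf_eq_typeOf_iff]
  constructor
  · intro h k
    have := h (aboveF G k 0)
    rw [realize_aboveF, realize_aboveF] at this
    exact this.2 (hx k)
  · intro h φ
    obtain ⟨K, F, -, hKF⟩ := exists_agree_realize_iff c φ
    refine hKF _ _ _ _ ⟨fun i j => ?_, fun k _ i => ?_, fun k _ i => ?_, fun g _ i j => ?_⟩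
    · exact iff_of_false (fun h => not_arc_of_lt c h none h) fun h => not_arc_of_lt c h none h
    · exact iff_of_false (not_below_of_above c (h k)) (not_below_of_above c (hx k))
    · exact iff_of_true (h k) (hx k)
    · have key {N : Theory.ModelType.{0, u, u} (ehrPolyTheory G c)} (b : N) : Act g b b ↔ g = 1 :=
        ⟨fun hb => Option.some.inj
            (arc_unique c (o := some g) (o' := some 1) hb ((act_one_iff c).2 rfl)),
          fun e => e ▸ (act_one_iff c).2 rfl⟩
      exact (key _).trans (key _).symm

/-- Two arcs of the same kind above `R_k`, `k < K`, cannot be told apart by the positions relative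
to these `R_k`. -/
theorem agree_of_arc {N N' : Type*} [(polyLang G).Structure N] [(polyLang G).Structure N']
    [N ⊨ ehrPolyTheory G c] [N' ⊨ ehrPolyTheory G c] {K : ℕ} {F : Set G} {o : Option G}
    {a b : N} {a' b' : N'} (ha : ∀ k < K, Above G k a) (ha' : ∀ k < K, Above G k a')
    (h : Arc o a b) (h' : Arc o a' b') : Agree K F ![a, b] ![a', b'] := by
  -- `Arc o'` holds at a given place of either pair for the same reason in both structures
  have fwd : ∀ o', Arc o' a b ↔ Arc o' a' b' := fun o' =>
    ⟨fun e => arc_unique c h e ▸ h', fun e => arc_unique c h' e ▸ h⟩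
  have diag : ∀ o', Arc o' a a ↔ Arc o' a' a' := fun o' => by
    have e : Arc (some (1 : G)) a a := (act_one_iff c).2 rfl
    have e' : Arc (some (1 : G)) a' a' := (act_one_iff c).2 rfl
    exact ⟨fun x => arc_unique c e x ▸ e', fun x => arc_unique c e' x ▸ e⟩
  have diag' : ∀ o', Arc o' b b ↔ Arc o' b' b' := fun o' => by
    have e : Arc (some (1 : G)) b b := (act_one_iff c).2 rfl
    have e' : Arc (some (1 : G)) b' b' := (act_one_iff c).2 rfl
    exact ⟨fun x => arc_unique c e x ▸ e', fun x => arc_unique c e' x ▸ e⟩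
  have bwd : ∀ o', Arc o' b a ↔ Arc o' b' a' := fun o' => by
    cases o with
    | none => exact iff_of_false (not_arc_of_lt c h o') (not_arc_of_lt c h' o')
    | some g =>
      have e : Arc (some g⁻¹) b a := act_inv c h
      have e' : Arc (some g⁻¹) b' a' := act_inv c h'
      exact ⟨fun x => arc_unique c e x ▸ e', fun x => arc_unique c e' x ▸ e⟩
  have arcs : ∀ (o' : Option G) (i j : Fin 2),
      Arc o' (![a, b] i) (![a, b] j) ↔ Arc o' (![a', b'] i) (![a', b'] j) := by
    intro o' i j
    fin_cases i <;> fin_cases j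
    · exact diag o'
    · exact fwd o'
    · exact bwd o'
    · exact diag' o'
  have above : ∀ k < K, ∀ i : Fin 2, Above G k (![a, b] i) ∧ Above G k (![a', b'] i) := by
    intro k hk i
    fin_cases i
    · exact ⟨ha k hk, ha' k hk⟩
    · exact ⟨above_of_arc c (ha k hk) h, above_of_arc c (ha' k hk) h'⟩
  exact ⟨arcs none,
    fun k hk i => iff_of_false (not_below_of_above c (above k hk i).1)
      (not_below_of_above c (above k hk i).2),
    fun k hk i => iff_of_true (above k hk i).1 (above k hk i).2, fun g _ => arcs (some g)⟩

end TypeAtInfinity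

/-! ### The isolating formulas over a realization of the type at infinity -/

section Isolating

variable {G : Type u} [Group G] {c : ℕ → ℚ} (hc : StrictMono c)

theorem exists_realizes :
    ∃ (M : Theory.ModelType.{0, u, u} (ehrPolyTheory G c)) (a : M),
      Realizes (typeAtInfinity G hc) a :=
  have ⟨M, a, ha⟩ := exists_forall_above (G := G) hc
  ⟨M, a, (realizes_typeAtInfinity_iff hc).2 ha⟩

theorem realizes_of_arc {M : Theory.ModelType.{0, u, u} (ehrPolyTheory G c)} {a b : M}
    {o : Option G} (ha : Realizes (typeAtInfinity G hc) a) (h : Arc o a b) :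
    Realizes (typeAtInfinity G hc) b :=
  (realizes_typeAtInfinity_iff hc).2 fun k =>
    above_of_arc c ((realizes_typeAtInfinity_iff hc).1 ha k) h

theorem arcF_mem_PF (o : Option G) : arcF o 0 1 ∈ PF (typeAtInfinity G hc) := by
  refine ⟨⟨?_, fun ψ => ?_⟩, fun M a b ha h => ?_⟩
  · obtain ⟨M, a, ha⟩ := exists_realizes (G := G) hc
    obtain ⟨b, hb⟩ := exists_arc c o a
    exact ⟨M, a, b, ha, (realize_arcF _ _ _ _).2 hb⟩
  · obtain ⟨K, F, -, hKF⟩ := exists_agree_realize_iff c ψ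
    by_cases H : Implies (typeAtInfinity G hc) (arcF o 0 1) ψ
    · exact Or.inl H
    · unfold Implies at H
      push Not at H
      obtain ⟨M, a, b, ha, hab, hψ⟩ := H
      refine Or.inr fun M' a' b' ha' hab' => ?_
      rw [realize_arcF] at hab hab'
      rw [Formula.realize_not, ← hKF M M' ![a, b] ![a', b'] ]
      · exact hψ
      · exact agree_of_arc (c := c) (fun k _ => (realizes_typeAtInfinity_iff hc).1 ha k)
          (fun k _ => (realizes_typeAtInfinity_iff hc).1 ha' k) hab hab'
  · exact realizes_of_arc hc ha ((realize_arcF _ _ _ _).1 h)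

/-- Over a realization `a` of the type at infinity, every isolating formula is one of `a < y` and
`Q_g(a, y)`. Suppose `φ` depends on the position relative to `R_k` for `k < K` only. It is realized
in `ℚ × G` by a pair `s` beyond these `R_k`. If `s 1 < s 0`, then `φ(a, z)` holds for every
`z ∈ R_K`, although `z` does not realize the type. Otherwise `s` is an arc, and all arcs of the same
kind satisfy `φ`. -/
theorem exists_realize_iff_arc {φ : (polyLang G).Formula (Fin 2)}
    (hφ : φ ∈ PF (typeAtInfinity G hc)) :
    ∃ o : Option G, ∀ (M : Theory.ModelType.{0, u, u} (ehrPolyTheory G c)) (a b : M),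
      Realizes (typeAtInfinity G hc) a → (φ.Realize ![a, b] ↔ Arc o a b) := by
  obtain ⟨⟨⟨M, a, b, ha, hab⟩, hiso⟩, himp⟩ := hφ
  obtain ⟨K, F, hF, hKF⟩ := exists_agree_realize_iff c φ
  obtain ⟨s, hs, hsφ⟩ := exists_agree c φ K hF ![a, b]
  have hs_eq : s = ![s 0, s 1] := funext fun i => by fin_cases i <;> rfl
  have ha' := (realizes_typeAtInfinity_iff hc).1 ha
  have hb' := (realizes_typeAtInfinity_iff hc).1 (himp M a b ha hab)
  have hs₀ : ∀ k < K, Above G k (s 0) := fun k hk => (hs.above k hk 0).2 (ha' k)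
  have hs₁ : ∀ k < K, Above G k (s 1) := fun k hk => (hs.above k hk 1).2 (hb' k)
  obtain ⟨o, ho⟩ : ∃ o : Option G, Arc o (s 0) (s 1) := by
    rcases lt_trichotomy (s 0).1 (s 1).1 with hlt | heq | hgt
    · exact ⟨none, lt_iff.2 hlt⟩
    · exact ⟨some ((s 0).2⁻¹ * (s 1).2), act_iff.2 ⟨heq, mul_inv_cancel_left _ _⟩⟩
    · obtain ⟨z, hz, hza⟩ := ha' K
      have hz' : ∀ k < K, Above G k z := fun k hk => above_of_const c hc hk hz
      have hagree : Agree K F ![s 1, s 0] ![z, a] :=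
        agree_of_arc (c := c) (o := none) hs₁ hz' (lt_iff.2 hgt) hza
      have hagree' : Agree K F s ![a, z] := by
        convert hagree.comp ![1, 0] using 1 <;> ext i <;> fin_cases i <;> rfl
      have hφz : φ.Realize ![a, z] := (hKF _ _ _ _ hagree').1 (hsφ.2 hab)
      exact absurd ((realizes_typeAtInfinity_iff hc).1 (himp M a z ha hφz) K)
        (not_above_of_const c hz)
  have harc : ∀ (N : Theory.ModelType.{0, u, u} (ehrPolyTheory G c)) (x y : N),
      Realizes (typeAtInfinity G hc) x → Arc o x y → φ.Realize ![x, y] := by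
    intro N x y hx hxy
    refine (hKF _ _ s _ ?_).1 (hsφ.2 hab)
    rw [hs_eq]
    exact agree_of_arc (c := c) hs₀ (fun k _ => (realizes_typeAtInfinity_iff hc).1 hx k) ho hxy
  refine ⟨o, fun N x y hx => ⟨fun hxy => ?_, harc N x y hx⟩⟩
  rcases hiso (arcF o 0 1) with H | H
  · exact (realize_arcF _ _ _ _).1 (H N x y hx hxy)
  · obtain ⟨z, hz⟩ := exists_arc c o x
    have := H N x z hx (harc N x z hx hz)
    rw [Formula.realize_not, realize_arcF] at this
    exact absurd hz this

/-- The class of the formula that defines `Arc o`. -/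
noncomputable def arcClass (o : Option G) : IsolatingClass (typeAtInfinity G hc) :=
  classOf ⟨arcF o 0 1, arcF_mem_PF hc o⟩

theorem classOf_eq_arcClass_iff {φ : PF (typeAtInfinity G hc)} {o : Option G} :
    classOf φ = arcClass hc o ↔
      ∀ (M : Theory.ModelType.{0, u, u} (ehrPolyTheory G c)) (a b : M),
        Realizes (typeAtInfinity G hc) a → (φ.1.Realize ![a, b] ↔ Arc o a b) := by
  refine Quotient.eq.trans (forall_congr' fun M => forall₃_congr fun a b _ => ?_)
  rw [realize_arcF]
  exact Iff.rfl

theorem arcClass_bijective : Function.Bijective (arcClass (G := G) hc) := by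
  constructor
  · intro o o' h
    obtain ⟨M, a, ha⟩ := exists_realizes (G := G) hc
    obtain ⟨b, hb⟩ := exists_arc c o a
    have := (classOf_eq_arcClass_iff hc).1 h M a b ha
    rw [realize_arcF] at this
    exact arc_unique c hb (this.1 hb)
  · intro E
    induction E using Quotient.inductionOn with
    | h φ =>
      obtain ⟨o, ho⟩ := exists_realize_iff_arc hc φ.2
      exact ⟨o, ((classOf_eq_arcClass_iff hc).2 ho).symm⟩

theorem isPrincipalArc_iff {M : Theory.ModelType.{0, u, u} (ehrPolyTheory G c)} {a b : M} :
    IsPrincipalArc (typeAtInfinity G hc) a b ↔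
      Realizes (typeAtInfinity G hc) a ∧ ∃ o : Option G, Arc o a b := by
  refine and_congr_right fun ha => ⟨?_, ?_⟩
  · rintro ⟨φ, hφ, hab⟩
    obtain ⟨o, ho⟩ := exists_realize_iff_arc hc hφ
    exact ⟨o, (ho M a b ha).1 hab⟩
  · rintro ⟨o, ho⟩
    exact ⟨_, arcF_mem_PF hc o, (realize_arcF _ _ _ _).2 ho⟩

theorem not_isPrincipalArc_of_lt {M : Theory.ModelType.{0, u, u} (ehrPolyTheory G c)} {a b : M}
    (h : Lt G a b) : ¬ IsPrincipalArc (typeAtInfinity G hc) b a := fun h' =>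
  have ⟨_, o, ho⟩ := (isPrincipalArc_iff hc).1 h'
  not_arc_of_lt c h o ho

theorem isPrincipalArc_of_act {M : Theory.ModelType.{0, u, u} (ehrPolyTheory G c)} {a b : M}
    {g : G} (ha : Realizes (typeAtInfinity G hc) a) (h : Act g a b) :
    IsPrincipalArc (typeAtInfinity G hc) b a :=
  (isPrincipalArc_iff hc).2 ⟨realizes_of_arc hc (o := some g) ha h, some g⁻¹, act_inv c h⟩

theorem arcClass_mem_PFN_iff {o : Option G} : arcClass hc o ∈ PFN (typeAtInfinity G hc) ↔
    o = none := by
  constructor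
  · rintro ⟨φ, hφ, h⟩
    cases o with
    | none => rfl
    | some g =>
      obtain ⟨M, a, ha⟩ := exists_realizes (G := G) hc
      obtain ⟨b, hb⟩ := exists_arc c (some g) a
      exact absurd (isPrincipalArc_of_act hc ha hb)
        (h M a b ha (((classOf_eq_arcClass_iff hc).1 hφ M a b ha).2 hb))
  · rintro rfl
    exact ⟨_, rfl, fun M a b _ h => not_isPrincipalArc_of_lt hc ((realize_ltF _ _ _).1 h)⟩

theorem arcClass_mem_PFS_iff {o : Option G} : arcClass hc o ∈ PFS (typeAtInfinity G hc) ↔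
    o ≠ none := by
  constructor
  · rintro ⟨φ, hφ, h⟩ rfl
    obtain ⟨M, a, ha⟩ := exists_realizes (G := G) hc
    obtain ⟨b, hb⟩ := exists_arc c (none : Option G) a
    exact not_isPrincipalArc_of_lt hc hb
      (h M a b ha (((classOf_eq_arcClass_iff hc).1 hφ M a b ha).2 hb))
  · intro h
    obtain ⟨g, rfl⟩ := Option.ne_none_iff_exists'.1 h
    exact ⟨_, rfl, fun M a b ha h => isPrincipalArc_of_act hc ha ((realize_actF _ _ _ _).1 h)⟩

theorem exists_classOf_eqFormula :
    ∃ h : eqFormula (polyLang G) ∈ PF (typeAtInfinity G hc),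
      classOf ⟨eqFormula (polyLang G), h⟩ = arcClass hc (some 1) := by
  have key (M : Theory.ModelType.{0, u, u} (ehrPolyTheory G c)) (a b : M) :
      (eqFormula (polyLang G)).Realize ![a, b] ↔ (arcF (some (1 : G)) 0 1).Realize ![a, b] := by
    rw [realize_arcF, eqFormula, Formula.realize_equal]
    exact (act_one_iff c).symm
  have h : eqFormula (polyLang G) ∈ PF (typeAtInfinity G hc) := by
    have := arcF_mem_PF hc (some (1 : G))
    simpa only [PF, IsPrincipal, Implies, Set.mem_ofPred_eq, key] using this
  exact ⟨h, Quotient.sound fun M a b _ => key M a b⟩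

end Isolating

/-! ### The labelling and its algebra -/

theorem bandOp_of_mem_right {U : Type u} {S₁ S₂ : Set U} (op₁ : S₁ → S₁ → S₁)
    (op₂ : S₂ → S₂ → S₂) {x y : ↥(S₁ ∪ S₂)} (h₁ : ¬ (x.1 ∈ S₁ ∧ y.1 ∈ S₁))
    (h₂ : x.1 ∈ S₂ ∧ y.1 ∈ S₂) :
    bandOp S₁ S₂ op₁ op₂ x y = ⟨op₂ ⟨x, h₂.1⟩ ⟨y, h₂.2⟩, Or.inr (Subtype.property _)⟩ :=
  (dif_neg h₁).trans (dif_pos h₂)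

section Labelling

variable {U : Type u} {A : Alphabet U} {m : U} (hm : m ∈ A.neg) {G : Set U} [Group G]
  (hG : G ⊆ A.nonneg) (hone : ((1 : G) : U) = A.zero)

/-- The label of an arc: `m` for `<`, and `g` for `Q_g`. -/
def arcLabel (m : U) : Option G → U
  | none => m
  | some g => g

theorem Alphabet.notMem_nonneg_of_mem_neg (hm : m ∈ A.neg) : m ∉ A.nonneg := by
  rintro (h | rfl)
  · exact A.disjoint_neg_pos.notMem_of_mem_left hm h
  · exact A.zero_notMem_neg hm

omit [Group G] in
include hm hG in
theorem arcLabel_injective : Function.Injective (arcLabel (G := G) m) := by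
  have hmG : m ∉ G := fun h => A.notMem_nonneg_of_mem_neg hm (hG h)
  rintro (_ | g) (_ | h) e
  · rfl
  · exact absurd (Set.mem_of_eq_of_mem e h.2) hmG
  · exact absurd (Set.mem_of_eq_of_mem e.symm g.2) hmG
  · exact congrArg some (Subtype.ext e)

omit [Group G] in
include hm hG in
theorem arcLabel_mem_neg_iff {o : Option G} : arcLabel m o ∈ A.neg ↔ o = none := by
  cases o with
  | none => exact iff_of_true hm rfl
  | some g => exact iff_of_false (fun h => A.notMem_nonneg_of_mem_neg h (hG g.2)) (by simp)

omit [Group G] in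
include hm hG in
theorem arcLabel_mem_nonneg_iff {o : Option G} : arcLabel m o ∈ A.nonneg ↔ o ≠ none := by
  cases o with
  | none => exact iff_of_false (A.notMem_nonneg_of_mem_neg hm) (by simp)
  | some g => exact iff_of_true (hG g.2) (by simp)

include hone in
theorem range_arcLabel : Set.range (arcLabel (G := G) m) = {m, A.zero} ∪ G := by
  ext w
  constructor
  · rintro ⟨_ | g, rfl⟩
    · exact Or.inl (Or.inl rfl)
    · exact Or.inr g.2
  · rintro ((rfl | rfl) | h)
    · exact ⟨none, rfl⟩
    · exact ⟨some 1, hone⟩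
    · exact ⟨some ⟨w, h⟩, rfl⟩

include hm hG hone in
/-- The composition of arcs is the operation of the successively-annihilating band. -/
theorem bandOp_arcLabel {x y : ↥(({m, A.zero} : Set U) ∪ G)} {o o' : Option G}
    (hx : arcLabel m o = x) (hy : arcLabel m o' = y) :
    (bandOp {m, A.zero} G (twoOp A m) (fun g h => g * h) x y : U) =
      arcLabel m (Arc.comp o o') := by
  obtain ⟨x, hx'⟩ := x
  obtain ⟨y, hy'⟩ := y
  simp only at hx hy
  subst hx hy
  have hm0 : m ≠ A.zero := fun h => A.zero_notMem_neg (h ▸ hm)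
  have hmG : m ∉ G := fun h => A.notMem_nonneg_of_mem_neg hm (hG h)
  have hgm (g : G) : (g : U) ≠ m := fun h => hmG (h ▸ g.2)
  have hg0 (g : G) : (g : U) = A.zero ↔ g = 1 := by rw [← hone]; exact Subtype.coe_inj
  cases o with
  | none =>
    cases o' with
    | none => simp [bandOp, twoOp, arcLabel, Arc.comp, hm0]
    | some g =>
      by_cases hg : (g : U) = A.zero <;>
        simp [bandOp, twoOp, arcLabel, Arc.comp, hm0, hmG, hg, hgm]
  | some g =>
    cases o' with
    | none =>
      by_cases hg : (g : U) = A.zero <;>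
        simp [bandOp, twoOp, arcLabel, Arc.comp, hmG, hg, hgm]
    | some h =>
      by_cases hgh : g = 1 ∧ h = 1
      · obtain ⟨rfl, rfl⟩ := hgh
        simp [bandOp, twoOp, arcLabel, Arc.comp, hone]
      · have h₁ : ¬ ((g : U) ∈ ({m, A.zero} : Set U) ∧ (h : U) ∈ ({m, A.zero} : Set U)) := by
          simpa [hgm, hg0] using hgh
        have h₂ : (g : U) ∈ G ∧ (h : U) ∈ G := ⟨g.2, h.2⟩
        exact congrArg Subtype.val (bandOp_of_mem_right _ _ h₁ h₂)

variable {c : ℕ → ℚ} (hc : StrictMono c)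

/-- The labelling of the isolating classes by `arcLabel`. -/
noncomputable def labelling (m : U) (E : IsolatingClass (typeAtInfinity G hc)) : U :=
  arcLabel m ((Equiv.ofBijective _ (arcClass_bijective hc)).symm E)

theorem labelling_arcClass (o : Option G) : labelling hc m (arcClass hc o) = arcLabel m o :=
  congrArg (arcLabel m) ((Equiv.ofBijective _ (arcClass_bijective hc)).symm_apply_apply o)

include hm hG hone in
theorem isRegularLabelling : IsRegularLabelling A (typeAtInfinity G hc) (labelling hc m) where
  injective := (arcLabel_injective hm hG).comp (Equiv.injective _)
  mem_neg_iff E := by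
    obtain ⟨o, rfl⟩ := (arcClass_bijective hc).2 E
    rw [labelling_arcClass, arcLabel_mem_neg_iff hm hG, arcClass_mem_PFN_iff]
  mem_nonneg_iff E := by
    obtain ⟨o, rfl⟩ := (arcClass_bijective hc).2 E
    rw [labelling_arcClass, arcLabel_mem_nonneg_iff hm hG, arcClass_mem_PFS_iff]
  eq_label :=
    have ⟨h, e⟩ := exists_classOf_eqFormula (G := G) hc
    ⟨h, by rw [e, labelling_arcClass]; exact hone⟩

include hm hG in
theorem labelProd_labelling (o o' : Option G) :
    labelProd (labelling (G := G) hc m) (arcLabel m o) (arcLabel m o') =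
      {arcLabel m (Arc.comp o o')} := by
  have key {φ : PF (typeAtInfinity G hc)} {o : Option G}
      (h : labelling hc m (classOf φ) = arcLabel m o) : classOf φ = arcClass hc o := by
    rw [← labelling_arcClass hc] at h
    exact (arcLabel_injective hm hG).comp (Equiv.injective _) h
  ext w
  rw [Set.mem_singleton_iff]
  constructor
  · rintro ⟨θ, θ₁, θ₂, rfl, h₁, h₂, h⟩
    obtain ⟨o₀, h₀⟩ := (arcClass_bijective hc).2 (classOf θ)
    rw [← h₀, labelling_arcClass]
    obtain ⟨M, a, ha⟩ := exists_realizes (G := G) hc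
    obtain ⟨b, hb⟩ := exists_arc c o₀ a
    obtain ⟨z, hz₁, hz₂⟩ :=
      h M a b ha (((classOf_eq_arcClass_iff hc).1 h₀.symm M a b ha).2 hb)
    have haz := ((classOf_eq_arcClass_iff hc).1 (key h₁) M a z ha).1 hz₁
    have hzb := ((classOf_eq_arcClass_iff hc).1 (key h₂) M z b (realizes_of_arc hc ha haz)).1 hz₂
    rw [arc_unique c hb ((arc_comp_iff c o o' a b).2 ⟨z, haz, hzb⟩)]
  · rintro rfl
    refine ⟨_, _, _, labelling_arcClass hc _, labelling_arcClass hc o, labelling_arcClass hc o',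
      fun M a b ha h => ?_⟩
    obtain ⟨z, hz₁, hz₂⟩ := (arc_comp_iff c o o' a b).1 ((realize_arcF _ _ _ _).1 h)
    exact ⟨z, (realize_arcF _ _ _ _).2 hz₁, (realize_arcF _ _ _ _).2 hz₂⟩

include hm hG hone in
theorem generatingAlgebraIs : GeneratingAlgebraIs (labelling (G := G) hc m) ({m, A.zero} ∪ G)
    (bandOp {m, A.zero} G (twoOp A m) fun x y => x * y) := by
  refine ⟨?_, fun w₁ w₂ => ?_⟩
  · rw [← range_arcLabel (G := G) hone]
    exact (Equiv.surjective _).range_comp (arcLabel m)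
  · obtain ⟨o₁, h₁⟩ : (w₁ : U) ∈ Set.range (arcLabel (G := G) m) :=
      (range_arcLabel (G := G) hone).symm ▸ w₁.2
    obtain ⟨o₂, h₂⟩ : (w₂ : U) ∈ Set.range (arcLabel (G := G) m) :=
      (range_arcLabel (G := G) hone).symm ▸ w₂.2
    rw [bandOp_arcLabel hm hG hone h₁ h₂, ← h₁, ← h₂, labelProd_labelling hm hG hc]

end Labelling

end IsolatingFormulas

/-- For every group on a set `G` of non-negative labels with unit `0`, the complete theory `T` of
Ehrenfeucht's example with points replaced by copies of the regular `G`-polygon has no finite models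
and has a 1-type `p` with a regular labelling `ν` for which the algebra `𝔓'` is the
successively-annihilating band `{m, 0}[G]`, where `m` is a negative idempotent label. -/
theorem theorem5p2 {U : Type*} [Infinite U] (A : IsolatingFormulas.Alphabet U)
    (m : U) (hm : m ∈ A.neg)
    (G : Set U) [Group G] (hG : G ⊆ A.nonneg) (hone : ((1 : G) : U) = A.zero)
    (c : ℕ → ℚ) (hc : StrictMono c) (hlim : Filter.Tendsto c Filter.atTop Filter.atTop) :
    (IsolatingFormulas.ehrPolyTheory G c).IsComplete ∧
    (∀ M : FirstOrder.Language.Theory.ModelType (IsolatingFormulas.ehrPolyTheory G c),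
      Infinite M) ∧
    (∀ n : ℕ, Cardinal.mk ((IsolatingFormulas.ehrPolyTheory G c).CompleteType (Fin n)) ≤
      Cardinal.mk U) ∧
    ∃ (p : (IsolatingFormulas.ehrPolyTheory G c).CompleteType (Fin 1))
      (ν : IsolatingFormulas.IsolatingClass p → U),
      IsolatingFormulas.IsRegularLabelling A p ν ∧
      IsolatingFormulas.GeneratingAlgebraIs ν ({m, A.zero} ∪ G)
        (IsolatingFormulas.bandOp {m, A.zero} G (IsolatingFormulas.twoOp A m)
          (fun x y => x * y)) := by
  refine ⟨completeTheory.isComplete _ _, fun M => IsolatingFormulas.infinite_of_model (G := G) c M,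
    IsolatingFormulas.mk_completeType_le hc (Cardinal.aleph0_le_mk U) (Cardinal.mk_set_le G),
    IsolatingFormulas.typeAtInfinity G hc, IsolatingFormulas.labelling hc m,
    IsolatingFormulas.isRegularLabelling hm hG hone hc,
    IsolatingFormulas.generatingAlgebraIs hm hG hone hc⟩
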